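/- Let $G=G_{*,*}$ be a bisimplicial group, i.e. a functor $\Delta^{op}\times\Delta^{op}\to\mathbf{Grp}$, with horizontal faces and degeneracies $d_i^h:G_{p,q}\to G_{p-1,q}$, $s_i^h:G_{p,q}\to G_{p+1,q}$ ($0\le i\le p$; faces for $p\ge 1$) and vertical ones $d_j^v:G_{p,q}\to G_{p,q-1}$, $s_j^v:G_{p,q}\to G_{p,q+1}$ ($0\le j\le q$; faces for $q\ge 1$). Let $$NG_{p,q}=\bigcap_{i=0}^{p-1}\ker\bigl(d_i^h:G_{p,q}\to G_{p-1,q}\bigr)\ \cap\ \bigcap_{j=0}^{q-1}\ker\bigl(d_j^v:G_{p,q}\to G_{p,q-1}\bigr)$$ be the Moore bicomplex of $G$, with boundaries $\partial_p^h:NG_{p,q}\to NG_{p-1,q}$ and $\partial_q^v:NG_{p,q}\to NG_{p,q-1}$ induced by the last faces $d_p^h$ and $d_q^v$, and let $D_{p,q}\le G_{p,q}$ be the subgroup generated by the degenerate elements, i.e. by the images of all $s_i^h:G_{p-1,q}\to G_{p,q}$ and all $s_j^v:G_{p,q-1}\to G_{p,q}$. Write $[k]=\{0,1,\dots,k\}$,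 and for subgroups $A,B$ let $[A,B]$ be the subgroup generated by the commutators of elements of $A$ with elements of $B$. (1) Let $n\ge 1$, $m\ge 2$, and let $I,J\subseteq[m-1]$ be non-empty with $I\cup J=[m-1]$. Then, in $G_{n,m-1}$, $$[K_I\cap K_H,\;K_J\cap K_H]\subseteq\partial_m^v\bigl(NG_{n,m}\cap D_{n,m}\bigr),$$ where $$K_H=\bigcap_{i=0}^{n-1}\ker\bigl(d_i^h:G_{n,m-1}\to G_{n-1,m-1}\bigr),\qquad K_I=\bigcap_{i\in I}\ker\bigl(d_i^v:G_{n,m-1}\to G_{n,m-2}\bigr),\qquad K_J=\bigcap_{j\in J}\ker\bigl(d_j^v:G_{n,m-1}\to G_{n,m-2}\bigr).$$ (2) Let $n\ge 2$, $m\ge 1$, and let $I',J'\subseteq[n-1]$ be non-empty with $I'\cup J'=[n-1]$. Then, in $G_{n-1,m}$, $$[K_{I'}\cap K_V,\;K_{J'}\cap K_V]\subseteq\partial_n^h\bigl(NG_{n,m}\cap D_{n,m}\bigr),$$ where $$K_V=\bigcap_{i=0}^{m-1}\ker\bigl(d_i^v:G_{n-1,m}\to G_{n-1,m-1}\bigr),\qquad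 K_{I'}=\bigcap_{i\in I'}\ker\bigl(d_i^h:G_{n-1,m}\to G_{n-2,m}\bigr),\qquad K_{J'}=\bigcap_{j\in J'}\ker\bigl(d_j^h:G_{n-1,m}\to G_{n-2,m}\bigr).$$ -/

import Mathlib

open CategoryTheory Opposite
open scoped Simplicial

universe u

/-- A bisimplicial group: a functor from `Δᵒᵖ × Δᵒᵖ` to the category of groups. -/
abbrev BisimplicialGroup : Type (u + 1) :=
  (SimplexCategoryᵒᵖ × SimplexCategoryᵒᵖ) ⥤ GrpCat.{u}

namespace BisimplicialGroup

/-- The group `G_{p,q}`; the first index is horizontal and the second is vertical. -/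
abbrev obj₂ (G : BisimplicialGroup.{u}) (p q : ℕ) : GrpCat.{u} :=
  G.obj (op ⦋p⦌, op ⦋q⦌)

/-- The horizontal face map `d_i^h : G_{p+1,q} → G_{p,q}`, `0 ≤ i ≤ p+1`. -/
def hFace (G : BisimplicialGroup.{u}) (p q : ℕ) (i : Fin (p + 2)) :
    G.obj₂ (p + 1) q →* G.obj₂ p q :=
  (G.map (Prod.mkHom (SimplexCategory.δ i).op (𝟙 (op ⦋q⦌)))).hom

/-- The vertical face map `d_j^v : G_{p,q+1} → G_{p,q}`, `0 ≤ j ≤ q+1`. -/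
def vFace (G : BisimplicialGroup.{u}) (p q : ℕ) (j : Fin (q + 2)) :
    G.obj₂ p (q + 1) →* G.obj₂ p q :=
  (G.map (Prod.mkHom (𝟙 (op ⦋p⦌)) (SimplexCategory.δ j).op)).hom

/-- The horizontal degeneracy map `s_i^h : G_{p,q} → G_{p+1,q}`, `0 ≤ i ≤ p`. -/
def hDegen (G : BisimplicialGroup.{u}) (p q : ℕ) (i : Fin (p + 1)) :
    G.obj₂ p q →* G.obj₂ (p + 1) q :=
  (G.map (Prod.mkHom (SimplexCategory.σ i).op (𝟙 (op ⦋q⦌)))).hom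

/-- The vertical degeneracy map `s_j^v : G_{p,q} → G_{p,q+1}`, `0 ≤ j ≤ q`. -/
def vDegen (G : BisimplicialGroup.{u}) (p q : ℕ) (j : Fin (q + 1)) :
    G.obj₂ p q →* G.obj₂ p (q + 1) :=
  (G.map (Prod.mkHom (𝟙 (op ⦋p⦌)) (SimplexCategory.σ j).op)).hom

/-- The intersection of the kernels of the horizontal faces `d_i^h` on `G_{p,q}`, `i ∈ S`,
where `S ⊆ {0, …, p}`. There are no horizontal faces on `G_{0,q}`, so for `p = 0` the
intersection is empty, i.e. it is the whole group. -/
def hKer (G : BisimplicialGroup.{u}) (p q : ℕ) (S : Set (Fin (p + 1))) :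
    Subgroup (G.obj₂ p q) :=
  match p, S with
  | 0, _ => ⊤
  | p + 1, S => ⨅ i ∈ S, (G.hFace p q i).ker

/-- The intersection of the kernels of the vertical faces `d_j^v` on `G_{p,q}`, `j ∈ S`,
where `S ⊆ {0, …, q}`. For `q = 0` it is the whole group. -/
def vKer (G : BisimplicialGroup.{u}) (p q : ℕ) (S : Set (Fin (q + 1))) :
    Subgroup (G.obj₂ p q) :=
  match q, S with
  | 0, _ => ⊤
  | q + 1, S => ⨅ j ∈ S, (G.vFace p q j).ker

/-- `K_H ≤ G_{p,q}`: the intersection of the kernels of `d_0^h, …, d_{p-1}^h`. -/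
def hMooreKer (G : BisimplicialGroup.{u}) (p q : ℕ) : Subgroup (G.obj₂ p q) :=
  G.hKer p q {i | (i : ℕ) < p}

/-- `K_V ≤ G_{p,q}`: the intersection of the kernels of `d_0^v, …, d_{q-1}^v`. -/
def vMooreKer (G : BisimplicialGroup.{u}) (p q : ℕ) : Subgroup (G.obj₂ p q) :=
  G.vKer p q {j | (j : ℕ) < q}

/-- The term `NG_{p,q}` of the Moore bicomplex: the intersection of the kernels of
`d_i^h`, `i < p`, and `d_j^v`, `j < q`. -/
def moore (G : BisimplicialGroup.{u}) (p q : ℕ) : Subgroup (G.obj₂ p q) :=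
  G.hMooreKer p q ⊓ G.vMooreKer p q

/-- The horizontally degenerate elements of `G_{p,q}`: the images of all `s_i^h`. -/
def hDegenerate (G : BisimplicialGroup.{u}) (p q : ℕ) : Set (G.obj₂ p q) :=
  match p with
  | 0 => ∅
  | p + 1 => ⋃ i, Set.range (G.hDegen p q i)

/-- The vertically degenerate elements of `G_{p,q}`: the images of all `s_j^v`. -/
def vDegenerate (G : BisimplicialGroup.{u}) (p q : ℕ) : Set (G.obj₂ p q) :=
  match q with
  | 0 => ∅
  | q + 1 => ⋃ j, Set.range (G.vDegen p q j)

/-- `D_{p,q}`: the subgroup of `G_{p,q}` generated by the degenerate elements. -/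
def degenerateSubgroup (G : BisimplicialGroup.{u}) (p q : ℕ) : Subgroup (G.obj₂ p q) :=
  Subgroup.closure (G.hDegenerate p q ∪ G.vDegenerate p q)

end BisimplicialGroup

/-!
The statement is about one direction at a time. Fixing the other index turns `G` into a simplicial
group `X`, and the kernel condition in the fixed direction is preserved by the degeneracies of `X`,
because it is cut out by homomorphisms commuting with them. So it suffices to fill the commutator
`⁅x, y⁆` inside the subgroup generated by the degeneracies of `x` and `y`.

Let `x, y ∈ X_{r+1}` be killed by the faces in `I` and in `J` respectively, where `I ∪ J` is
everything, so that all faces of `c = ⁅x, y⁆` are trivial. Say that `c` is *filled in position `k`*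
if some such `z` has `d_k z = c` and all its other faces trivial; position `r + 2` is the required
one.

* The faces of `s_k c` are `c` in positions `k` and `k + 1` and trivial elsewhere. Hence a filling
  in position `k` gives one in position `k + 1`, and conversely
  (`SimplicialGroup.hasFilling_castSucc_iff_succ`).
* As `I` and `J` are non-empty and cover the index set, some two adjacent indices `k`, `k + 1` lie in
  `I` and `J`, in one order or the other (`exists_adjacent_of_union_eq_univ`). If `k ∈ I` and
  `k + 1 ∈ J`, then `⁅s_{k+1} x, s_k y⁆` is a filling in position `k + 1`
  (`SimplicialGroup.hasFilling_of_adjacent`); in the other order, exchange `x` and `y`.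
-/

/-- Two non-empty sets covering `{0, …, r + 1}` contain adjacent indices, one in each of them. -/
theorem exists_adjacent_of_union_eq_univ {r : ℕ} {I J : Set (Fin (r + 2))} (hI : I.Nonempty)
    (hJ : J.Nonempty) (hIJ : I ∪ J = Set.univ) :
    ∃ k : Fin (r + 1), (k.castSucc ∈ I ∧ k.succ ∈ J) ∨ (k.castSucc ∈ J ∧ k.succ ∈ I) := by
  have key : ∀ A B : Set (Fin (r + 2)), B.Nonempty → A ∪ B = Set.univ → 0 ∈ A →
      ∃ k : Fin (r + 1), (k.castSucc ∈ A ∧ k.succ ∈ B) ∨ (k.castSucc ∈ B ∧ k.succ ∈ A) := by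
    intro A B hB hAB h0
    by_contra! hcon
    -- Without such a `k`, membership in `A` propagates from `0` to every index.
    have hA : ∀ i, i ∈ A := by
      intro i
      induction i using Fin.induction with
      | zero => exact h0
      | succ i ih =>
        exact (hAB ▸ Set.mem_univ i.succ : i.succ ∈ A ∪ B).resolve_right ((hcon i).1 ih)
    obtain ⟨j, hj⟩ := hB
    induction j using Fin.cases with
    | zero => exact (hcon 0).2 hj (hA _)
    | succ j => exact (hcon j).1 (hA _) hj
  rcases (hIJ ▸ Set.mem_univ 0 : (0 : Fin (r + 2)) ∈ I ∪ J) with h | h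
  · exact key I J hJ hIJ h
  · obtain ⟨k, hk⟩ := key J I hI (Set.union_comm I J ▸ hIJ) h
    exact ⟨k, hk.symm⟩

namespace SimplicialGroup

open scoped commutatorElement

/-! ### Faces of degenerate elements -/

variable {X : SimplicialObject GrpCat.{u}} {r : ℕ}

theorem face_castSucc_degen (k : Fin (r + 2)) (x : X _⦋r + 1⦌) :
    (X.δ k.castSucc).hom ((X.σ k).hom x) = x :=
  ConcreteCategory.congr_hom (X.δ_comp_σ_self (i := k)) x

theorem face_succ_degen (k : Fin (r + 2)) (x : X _⦋r + 1⦌) :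
    (X.δ k.succ).hom ((X.σ k).hom x) = x :=
  ConcreteCategory.congr_hom (X.δ_comp_σ_succ (i := k)) x

theorem face_degen_eq_one_of_lt {k a : Fin (r + 2)} {x : X _⦋r + 1⦌} (hak : a < k)
    (hx : (X.δ a).hom x = 1) : (X.δ a.castSucc).hom ((X.σ k).hom x) = 1 := by
  obtain ⟨b, rfl⟩ := Fin.exists_succ_eq.2 (Fin.ne_zero_of_lt hak)
  have h := ConcreteCategory.congr_hom
    (X.δ_comp_σ_of_le (i := a) (j := b) (Fin.le_castSucc_iff.2 hak)) x
  have h' : (X.δ a.castSucc).hom ((X.σ b.succ).hom x) = (X.σ b).hom ((X.δ a).hom x) := h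
  rw [h', hx, map_one]

theorem face_degen_eq_one_of_gt {k a : Fin (r + 2)} {x : X _⦋r + 1⦌} (hka : k < a)
    (hx : (X.δ a).hom x = 1) : (X.δ a.succ).hom ((X.σ k).hom x) = 1 := by
  obtain ⟨b, rfl⟩ := Fin.exists_castSucc_eq.2 (Fin.ne_last_of_lt hka)
  have h := ConcreteCategory.congr_hom (X.δ_comp_σ_of_gt (i := a) (j := b) hka) x
  have h' : (X.δ a.succ).hom ((X.σ b.castSucc).hom x) = (X.σ b).hom ((X.δ a).hom x) := h
  rw [h', hx, map_one]

/-! ### Filling a commutator in one position -/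

/-- The subgroup of `X_{r+2}` generated by all degeneracies `s_k x` and `s_k y` of two elements
of `X_{r+1}`. -/
def degenSpan (x y : X _⦋r + 1⦌) : Subgroup (X _⦋r + 2⦌) :=
  ⨆ k : Fin (r + 2), (Subgroup.closure {x, y}).map (X.σ k).hom

theorem degen_mem_degenSpan {x y w : X _⦋r + 1⦌} (k : Fin (r + 2))
    (hw : w ∈ Subgroup.closure {x, y}) : (X.σ k).hom w ∈ degenSpan x y :=
  Subgroup.mem_iSup_of_mem k (Subgroup.mem_map_of_mem _ hw)

theorem degenSpan_comm (x y : X _⦋r + 1⦌) : degenSpan x y = degenSpan y x := by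
  rw [degenSpan, degenSpan, Set.pair_comm]

theorem commutator_mem_closure_pair {A : Type*} [Group A] (x y : A) :
    ⁅x, y⁆ ∈ Subgroup.closure {x, y} := by
  have hx : x ∈ Subgroup.closure {x, y} := Subgroup.subset_closure (by simp)
  have hy : y ∈ Subgroup.closure {x, y} := Subgroup.subset_closure (by simp)
  exact mul_mem (mul_mem (mul_mem hx hy) (inv_mem hx)) (inv_mem hy)

/-- The commutator `⁅x, y⁆` can be filled in position `k`: an element generated by degeneracies of
`x` and `y` has `k`-th face `⁅x, y⁆` and all other faces trivial. -/
def HasFilling (x y : X _⦋r + 1⦌) (k : Fin (r + 3)) : Prop :=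
  ∃ z ∈ degenSpan x y, (X.δ k).hom z = ⁅x, y⁆ ∧ ∀ l, l ≠ k → (X.δ l).hom z = 1

theorem HasFilling.symm {x y : X _⦋r + 1⦌} {k : Fin (r + 3)} (h : HasFilling x y k) :
    HasFilling y x k := by
  obtain ⟨z, hz, hk, hl⟩ := h
  refine ⟨z⁻¹, inv_mem (degenSpan_comm x y ▸ hz), ?_, fun l hlk => ?_⟩
  · rw [map_inv, hk, commutatorElement_inv]
  · rw [map_inv, hl l hlk, inv_one]

theorem face_degen_eq_one {k : Fin (r + 2)} {c : X _⦋r + 1⦌} (hc : ∀ a, (X.δ a).hom c = 1)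
    {l : Fin (r + 3)} (h₁ : l ≠ k.castSucc) (h₂ : l ≠ k.succ) :
    (X.δ l).hom ((X.σ k).hom c) = 1 := by
  rcases lt_or_gt_of_ne h₁ with h | h
  · obtain ⟨a, rfl⟩ := Fin.exists_castSucc_eq.2 (Fin.ne_last_of_lt h)
    exact face_degen_eq_one_of_lt (Fin.castSucc_lt_castSucc_iff.1 h) (hc a)
  · obtain ⟨a, rfl⟩ := Fin.exists_succ_eq.2 (Fin.ne_zero_of_lt h)
    have hka : k ≤ a := Fin.castSucc_lt_succ_iff.1 h
    exact face_degen_eq_one_of_gt (lt_of_le_of_ne hka fun e => h₂ (e ▸ rfl)) (hc a)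

/-- If all faces of `⁅x, y⁆` are trivial, multiplying the inverse of a filling by `s_k ⁅x, y⁆` moves
it between the positions `k` and `k + 1`. -/
theorem hasFilling_castSucc_iff_succ {x y : X _⦋r + 1⦌} (hc : ∀ a, (X.δ a).hom ⁅x, y⁆ = 1)
    (k : Fin (r + 2)) : HasFilling x y k.castSucc ↔ HasFilling x y k.succ := by
  have hne : k.castSucc ≠ k.succ := Fin.castSucc_lt_succ.ne
  have hs := degen_mem_degenSpan k (commutator_mem_closure_pair x y)
  constructor
  · rintro ⟨z, hz, hk, hl⟩
    refine ⟨z⁻¹ * (X.σ k).hom ⁅x, y⁆, mul_mem (inv_mem hz) hs, ?_, fun l hlk => ?_⟩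
    · rw [map_mul, map_inv, hl _ hne.symm, face_succ_degen, inv_one, one_mul]
    · rcases eq_or_ne l k.castSucc with rfl | h
      · rw [map_mul, map_inv, hk, face_castSucc_degen, inv_mul_cancel]
      · rw [map_mul, map_inv, hl _ h, face_degen_eq_one hc h hlk, inv_one, one_mul]
  · rintro ⟨z, hz, hk, hl⟩
    refine ⟨z⁻¹ * (X.σ k).hom ⁅x, y⁆, mul_mem (inv_mem hz) hs, ?_, fun l hlk => ?_⟩
    · rw [map_mul, map_inv, hl _ hne, face_castSucc_degen, inv_one, one_mul]
    · rcases eq_or_ne l k.succ with rfl | h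
      · rw [map_mul, map_inv, hk, face_succ_degen, inv_mul_cancel]
      · rw [map_mul, map_inv, hl _ h, face_degen_eq_one hc hlk h, inv_one, one_mul]

/-- A filling in any position can be moved to the last position. -/
theorem HasFilling.last {x y : X _⦋r + 1⦌} (hc : ∀ a, (X.δ a).hom ⁅x, y⁆ = 1) {k : Fin (r + 3)}
    (h : HasFilling x y k) : HasFilling x y (Fin.last (r + 2)) := by
  induction k using Fin.reverseInduction with
  | last => exact h
  | cast k ih => exact ih ((hasFilling_castSucc_iff_succ hc k).1 h)

/-- If `d_k x = 1`, `d_{k+1} y = 1`, and each other face kills `x` or `y`, then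
`⁅s_{k+1} x, s_k y⁆` fills `⁅x, y⁆` in position `k + 1`. -/
theorem hasFilling_of_adjacent {x y : X _⦋r + 1⦌}
    (hxy : ∀ a, (X.δ a).hom x = 1 ∨ (X.δ a).hom y = 1) {k : Fin (r + 1)}
    (hx : (X.δ k.castSucc).hom x = 1) (hy : (X.δ k.succ).hom y = 1) :
    HasFilling x y k.succ.castSucc := by
  have hmx := degen_mem_degenSpan (x := x) (y := y) k.succ (w := x)
    (Subgroup.subset_closure (by simp))
  have hmy := degen_mem_degenSpan (x := x) (y := y) k.castSucc (w := y)
    (Subgroup.subset_closure (by simp))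
  have hlt : k.castSucc < k.succ := Fin.castSucc_lt_succ
  refine ⟨⁅(X.σ k.succ).hom x, (X.σ k.castSucc).hom y⁆,
    mul_mem (mul_mem (mul_mem hmx hmy) (inv_mem hmx)) (inv_mem hmy), ?_, fun l hlk => ?_⟩
  · rw [map_commutatorElement, face_castSucc_degen, ← Fin.succ_castSucc, face_succ_degen]
  · rw [map_commutatorElement]
    rcases lt_or_gt_of_ne hlk with h | h
    · obtain ⟨a, rfl⟩ := Fin.exists_castSucc_eq.2 (Fin.ne_last_of_lt h)
      have ha : a < k.succ := Fin.castSucc_lt_castSucc_iff.1 h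
      by_cases hax : (X.δ a).hom x = 1
      · rw [face_degen_eq_one_of_lt ha hax, commutatorElement_one_left]
      · have hak : a < k.castSucc :=
          lt_of_le_of_ne (Fin.le_castSucc_iff.2 ha) fun e => hax (e ▸ hx)
        rw [face_degen_eq_one_of_lt hak ((hxy a).resolve_left hax), commutatorElement_one_right]
    · obtain ⟨a, rfl⟩ := Fin.exists_succ_eq.2 (Fin.ne_zero_of_lt h)
      have ha : k.succ ≤ a := Fin.castSucc_lt_succ_iff.1 h
      by_cases hay : (X.δ a).hom y = 1
      · rw [face_degen_eq_one_of_gt (hlt.trans_le ha) hay, commutatorElement_one_right]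
      · have hka : k.succ < a := lt_of_le_of_ne ha fun e => hay (e ▸ hy)
        rw [face_degen_eq_one_of_gt hka ((hxy a).resolve_right hay), commutatorElement_one_left]

/-- If the faces killing `x` and those killing `y` are indexed by non-empty sets covering
everything, then `⁅x, y⁆` is the last face of an element generated by degeneracies of `x` and `y`
whose other faces are trivial. -/
theorem hasFilling_last {x y : X _⦋r + 1⦌} {I J : Set (Fin (r + 2))} (hI : I.Nonempty)
    (hJ : J.Nonempty) (hIJ : I ∪ J = Set.univ) (hx : ∀ i ∈ I, (X.δ i).hom x = 1)
    (hy : ∀ j ∈ J, (X.δ j).hom y = 1) : HasFilling x y (Fin.last (r + 2)) := by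
  have hxy : ∀ a, (X.δ a).hom x = 1 ∨ (X.δ a).hom y = 1 := fun a =>
    (hIJ ▸ Set.mem_univ a : a ∈ I ∪ J).imp (hx a) (hy a)
  have hc : ∀ a, (X.δ a).hom ⁅x, y⁆ = 1 := by
    intro a
    rw [map_commutatorElement]
    rcases hxy a with h | h
    · rw [h, commutatorElement_one_left]
    · rw [h, commutatorElement_one_right]
  obtain ⟨k, ⟨hk, hk'⟩ | ⟨hk, hk'⟩⟩ := exists_adjacent_of_union_eq_univ hI hJ hIJ
  · exact (hasFilling_of_adjacent hxy (hx _ hk) (hy _ hk')).last hc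
  · exact (hasFilling_of_adjacent (fun a => (hxy a).symm) (hy _ hk) (hx _ hk')).symm.last hc

theorem degenSpan_le {x y : X _⦋r + 1⦌} {S : Subgroup (X _⦋r + 2⦌)}
    (hx : ∀ k, (X.σ k).hom x ∈ S) (hy : ∀ k, (X.σ k).hom y ∈ S) : degenSpan x y ≤ S := by
  refine iSup_le fun k => Subgroup.map_le_iff_le_comap.2 ((Subgroup.closure_le _).2 ?_)
  rintro w (rfl | rfl)
  · exact hx k
  · exact hy k

end SimplicialGroup

/-! ### Rows and columns of a bisimplicial group -/

namespace BisimplicialGroup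

variable (G : BisimplicialGroup.{u})

/-- The simplicial group `G_{p,*}`, whose faces and degeneracies are the vertical ones of `G`. -/
abbrev column (p : ℕ) : SimplicialObject GrpCat.{u} :=
  CategoryTheory.Prod.sectR (op ⦋p⦌) SimplexCategoryᵒᵖ ⋙ G

/-- The simplicial group `G_{*,q}`, whose faces and degeneracies are the horizontal ones of `G`. -/
abbrev row (q : ℕ) : SimplicialObject GrpCat.{u} :=
  CategoryTheory.Prod.sectL SimplexCategoryᵒᵖ (op ⦋q⦌) ⋙ G

variable {G}

theorem mem_vKer_succ {p q : ℕ} {S : Set (Fin (q + 2))} {x : G.obj₂ p (q + 1)} :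
    x ∈ G.vKer p (q + 1) S ↔ ∀ j ∈ S, G.vFace p q j x = 1 := by
  simp [vKer, Subgroup.mem_iInf, MonoidHom.mem_ker]

theorem mem_hKer_succ {p q : ℕ} {S : Set (Fin (p + 2))} {x : G.obj₂ (p + 1) q} :
    x ∈ G.hKer (p + 1) q S ↔ ∀ i ∈ S, G.hFace p q i x = 1 := by
  simp [hKer, Subgroup.mem_iInf, MonoidHom.mem_ker]

theorem hFace_vDegen {p q : ℕ} (i : Fin (p + 2)) (j : Fin (q + 1)) (x : G.obj₂ (p + 1) q) :
    G.hFace p (q + 1) i (G.vDegen (p + 1) q j x) = G.vDegen p q j (G.hFace p q i x) := by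
  have h : G.map (Prod.mkHom (𝟙 (op ⦋p + 1⦌)) (SimplexCategory.σ j).op) ≫
        G.map (Prod.mkHom (SimplexCategory.δ i).op (𝟙 (op ⦋q + 1⦌))) =
      G.map (Prod.mkHom (SimplexCategory.δ i).op (𝟙 (op ⦋q⦌))) ≫
        G.map (Prod.mkHom (𝟙 (op ⦋p⦌)) (SimplexCategory.σ j).op) := by
    rw [← G.map_comp, ← G.map_comp]
    congr 1
  exact ConcreteCategory.congr_hom h x

theorem vFace_hDegen {p q : ℕ} (i : Fin (p + 1)) (j : Fin (q + 2)) (x : G.obj₂ p (q + 1)) :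
    G.vFace (p + 1) q j (G.hDegen p (q + 1) i x) = G.hDegen p q i (G.vFace p q j x) := by
  have h : G.map (Prod.mkHom (SimplexCategory.σ i).op (𝟙 (op ⦋q + 1⦌))) ≫
        G.map (Prod.mkHom (𝟙 (op ⦋p + 1⦌)) (SimplexCategory.δ j).op) =
      G.map (Prod.mkHom (𝟙 (op ⦋p⦌)) (SimplexCategory.δ j).op) ≫
        G.map (Prod.mkHom (SimplexCategory.σ i).op (𝟙 (op ⦋q⦌))) := by
    rw [← G.map_comp, ← G.map_comp]
    congr 1
  exact ConcreteCategory.congr_hom h x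

theorem vDegen_mem_hMooreKer {p q : ℕ} {x : G.obj₂ p q} (hx : x ∈ G.hMooreKer p q)
    (j : Fin (q + 1)) : G.vDegen p q j x ∈ G.hMooreKer p (q + 1) := by
  cases p with
  | zero => exact Subgroup.mem_top _
  | succ p =>
    exact mem_hKer_succ.2 fun i hi => by rw [hFace_vDegen, mem_hKer_succ.1 hx i hi, map_one]

theorem hDegen_mem_vMooreKer {p q : ℕ} {x : G.obj₂ p q} (hx : x ∈ G.vMooreKer p q)
    (i : Fin (p + 1)) : G.hDegen p q i x ∈ G.vMooreKer (p + 1) q := by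
  cases q with
  | zero => exact Subgroup.mem_top _
  | succ q =>
    exact mem_vKer_succ.2 fun j hj => by rw [vFace_hDegen, mem_vKer_succ.1 hx j hj, map_one]

theorem vDegen_mem_degenerateSubgroup {p q : ℕ} (j : Fin (q + 1)) (x : G.obj₂ p q) :
    G.vDegen p q j x ∈ G.degenerateSubgroup p (q + 1) :=
  Subgroup.subset_closure (Or.inr (Set.mem_iUnion.2 ⟨j, x, rfl⟩))

theorem hDegen_mem_degenerateSubgroup {p q : ℕ} (i : Fin (p + 1)) (x : G.obj₂ p q) :
    G.hDegen p q i x ∈ G.degenerateSubgroup (p + 1) q :=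
  Subgroup.subset_closure (Or.inl (Set.mem_iUnion.2 ⟨i, x, rfl⟩))

theorem vertical_commutator_le (n r : ℕ) {I J : Set (Fin (r + 2))} (hI : I.Nonempty)
    (hJ : J.Nonempty) (hIJ : I ∪ J = Set.univ) :
    ⁅G.vKer n (r + 1) I ⊓ G.hMooreKer n (r + 1), G.vKer n (r + 1) J ⊓ G.hMooreKer n (r + 1)⁆ ≤
      (G.moore n (r + 2) ⊓ G.degenerateSubgroup n (r + 2)).map
        (G.vFace n (r + 1) (Fin.last (r + 2))) := by
  refine Subgroup.commutator_le.2 fun x hx y hy => ?_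
  obtain ⟨z, hz, hlast, hne⟩ := SimplicialGroup.hasFilling_last (X := G.column n) hI hJ hIJ
    (mem_vKer_succ.1 hx.1) (mem_vKer_succ.1 hy.1)
  have hzS := SimplicialGroup.degenSpan_le (X := G.column n)
    (S := G.hMooreKer n (r + 2) ⊓ G.degenerateSubgroup n (r + 2))
    (fun k => ⟨vDegen_mem_hMooreKer hx.2 k, vDegen_mem_degenerateSubgroup k x⟩)
    (fun k => ⟨vDegen_mem_hMooreKer hy.2 k, vDegen_mem_degenerateSubgroup k y⟩) hz
  exact ⟨z, ⟨⟨hzS.1, mem_vKer_succ.2 fun j hj => hne j (Fin.ne_last_of_lt (b := Fin.last _) hj)⟩,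
    hzS.2⟩, hlast⟩

theorem horizontal_commutator_le (r m : ℕ) {I J : Set (Fin (r + 2))} (hI : I.Nonempty)
    (hJ : J.Nonempty) (hIJ : I ∪ J = Set.univ) :
    ⁅G.hKer (r + 1) m I ⊓ G.vMooreKer (r + 1) m, G.hKer (r + 1) m J ⊓ G.vMooreKer (r + 1) m⁆ ≤
      (G.moore (r + 2) m ⊓ G.degenerateSubgroup (r + 2) m).map
        (G.hFace (r + 1) m (Fin.last (r + 2))) := by
  refine Subgroup.commutator_le.2 fun x hx y hy => ?_
  obtain ⟨z, hz, hlast, hne⟩ := SimplicialGroup.hasFilling_last (X := G.row m) hI hJ hIJ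
    (mem_hKer_succ.1 hx.1) (mem_hKer_succ.1 hy.1)
  have hzS := SimplicialGroup.degenSpan_le (X := G.row m)
    (S := G.vMooreKer (r + 2) m ⊓ G.degenerateSubgroup (r + 2) m)
    (fun k => ⟨hDegen_mem_vMooreKer hx.2 k, hDegen_mem_degenerateSubgroup k x⟩)
    (fun k => ⟨hDegen_mem_vMooreKer hy.2 k, hDegen_mem_degenerateSubgroup k y⟩) hz
  exact ⟨z, ⟨⟨mem_hKer_succ.2 fun i hi => hne i (Fin.ne_last_of_lt (b := Fin.last _) hi), hzS.1⟩,
    hzS.2⟩, hlast⟩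

end BisimplicialGroup

/-- In the vertical part the `m` of the usual formulation is `q + 1`, so that
`I, J ⊆ [m - 1] = {0, …, q}`, the commutator is formed in `G_{n,m-1} = G_{n,q}`, and `∂_m^v` is
induced by the last vertical face `G_{n,q+1} → G_{n,q}`. In the horizontal part `n` is `p + 1`. -/
theorem mainTheorem1 (G : BisimplicialGroup.{u}) :
    (∀ n q : ℕ, 1 ≤ n → 2 ≤ q + 1 →
      ∀ I J : Set (Fin (q + 1)), I.Nonempty → J.Nonempty → I ∪ J = Set.univ →
        ⁅G.vKer n q I ⊓ G.hMooreKer n q, G.vKer n q J ⊓ G.hMooreKer n q⁆ ≤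
          (G.moore n (q + 1) ⊓ G.degenerateSubgroup n (q + 1)).map
            (G.vFace n q (Fin.last (q + 1)))) ∧
    (∀ p m : ℕ, 2 ≤ p + 1 → 1 ≤ m →
      ∀ I' J' : Set (Fin (p + 1)), I'.Nonempty → J'.Nonempty → I' ∪ J' = Set.univ →
        ⁅G.hKer p m I' ⊓ G.vMooreKer p m, G.hKer p m J' ⊓ G.vMooreKer p m⁆ ≤
          (G.moore (p + 1) m ⊓ G.degenerateSubgroup (p + 1) m).map
            (G.hFace p m (Fin.last (p + 1)))) := by
  refine ⟨fun n q _ hq I J hI hJ hIJ => ?_, fun p m hp _ I J hI hJ hIJ => ?_⟩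
  · obtain ⟨r, rfl⟩ : ∃ r, q = r + 1 := ⟨q - 1, by omega⟩
    exact BisimplicialGroup.vertical_commutator_le n r hI hJ hIJ
  · obtain ⟨r, rfl⟩ : ∃ r, p = r + 1 := ⟨p - 1, by omega⟩
    exact BisimplicialGroup.horizontal_commutator_le r m hI hJ hIJ
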